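/- Let $X$ be an arbitrary topological space (unbased, possibly empty). Let $\pi_0^{\mathrm{qtop}}(X)$ be the set of path components of $X$ with the quotient topology from $X$. For a space $Y$, let $F_M(Y)$ be the free Markov topological group on $Y$: the free group on the set $Y$ with the finest group topology making the inclusion of generators $\sigma\colon Y\to F_M(Y)$ continuous, so that every continuous map from $Y$ to a topological group extends uniquely to a continuous homomorphism on $F_M(Y)$. For a based space $(Z,z_0)$, let $\pi_1^{\mathrm{qtop}}(Z,z_0)$ be the fundamental group with the quotient topology from the loop space $\Omega(Z,z_0)$ (compact-open topology), and let $\pi_1^{\tau}(Z,z_0)$ be the topological group obtained by giving $\pi_1(Z,z_0)$ the quotient topology along the homomorphism $F_M(\pi_1^{\mathrm{qtop}}(Z,z_0))\to\pi_1(Z,z_0)$ that extends the identity. Let $\Sigma(X_+)$ be the reduced suspension of $X_+=X\sqcup\{\ast\}$ (the space $X$ with an isolated basepoint added), that is, the quotient of $X_+\times[0,1]$ that collapses $X_+\times\{0,1\}\cup\{\ast\}\times[0,1]$ to the basepoint, and write $x\wedge t$ for the image of $(x,t)$. \textbf{Theorem.} There are isomorphisms of topological groups (group isomorphisms that are homeomorphisms)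 $$h_X\colon F_M(\pi_0^{\mathrm{qtop}}(X))\longrightarrow \pi_1^{\tau}(\Sigma(X_+)),$$ one for every topological space $X$, such that $h_X(\sigma([x]))$ is the class of the loop $u_x(t)=x\wedge t$ for every $x\in X$, and which are natural in $X$: for every continuous map $f\colon X\to Y$, $$h_Y\circ F_M(\pi_0^{\mathrm{qtop}}(f))=\pi_1^{\tau}(\Sigma(f_+))\circ h_X .$$ Thus $\pi_1^{\tau}(\Sigma(X_+))$, with the map $[x]\mapsto[u_x]$, is the free Markov topological group on the path-component space of $X$. -/

import Mathlib

open scoped unitInterval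

universe u v

noncomputable section

namespace TopPiOne

/-! ### Free (Markov) topological groups -/

/-- The free Markov topological group `F_M(Y)` on a space `Y`: the free group on the underlying set
of `Y`, with the finest group topology for which the inclusion of generators is continuous. Its
universal property is given by `FreeTopGroup.lift`, `FreeTopGroup.lift_of` and
`FreeTopGroup.hom_ext`. -/
def FreeTopGroup (Y : Type u) : Type u := FreeGroup Y

namespace FreeTopGroup

instance (Y : Type u) : Group (FreeTopGroup Y) := inferInstanceAs (Group (FreeGroup Y))

/-- The inclusion of generators `σ : Y → F_M(Y)`. -/
def of {Y : Type u} (y : Y) : FreeTopGroup Y := FreeGroup.of y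

instance (Y : Type u) [TopologicalSpace Y] : TopologicalSpace (FreeTopGroup Y) :=
  (GroupTopology.coinduced (of : Y → FreeTopGroup Y)).toTopologicalSpace

instance (Y : Type u) [TopologicalSpace Y] : IsTopologicalGroup (FreeTopGroup Y) :=
  (GroupTopology.coinduced (of : Y → FreeTopGroup Y)).toIsTopologicalGroup

theorem continuous_of {Y : Type u} [TopologicalSpace Y] :
    Continuous (of : Y → FreeTopGroup Y) :=
  GroupTopology.coinduced_continuous _

/-- The homomorphism `F(Y) → G` extending a function `Y → G`. -/
def liftHom {Y : Type u} {G : Type v} [Group G] (f : Y → G) : FreeTopGroup Y →* G :=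
  FreeGroup.lift f

theorem liftHom_of {Y : Type u} {G : Type v} [Group G] (f : Y → G) (y : Y) :
    liftHom f (of y) = f y :=
  FreeGroup.lift_apply_of

theorem continuous_liftHom {Y : Type u} {G : Type v} [TopologicalSpace Y] [Group G]
    [t : TopologicalSpace G] [IsTopologicalGroup G] {f : Y → G} (hf : Continuous f) :
    Continuous (liftHom f) := by
  let s : GroupTopology (FreeTopGroup Y) :=
    { toTopologicalSpace := TopologicalSpace.induced (liftHom f) t
      toIsTopologicalGroup := topologicalGroup_induced (liftHom f) }
  refine continuous_iff_le_induced.2 ?_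
  have hs : GroupTopology.coinduced (of : Y → FreeTopGroup Y) ≤ s := by
    refine sInf_le ?_
    refine continuous_iff_coinduced_le.1 (continuous_induced_rng.2 ?_)
    have : (liftHom f) ∘ (of : Y → FreeTopGroup Y) = f := funext (liftHom_of f)
    rw [this]
    exact hf
  exact hs

/-- The continuous homomorphism `F_M(Y) → G` to a topological group extending a continuous map
`Y → G`. -/
def lift {Y : Type u} {G : Type v} [TopologicalSpace Y] [Group G]
    [TopologicalSpace G] [IsTopologicalGroup G] (f : C(Y, G)) : FreeTopGroup Y →ₜ* G where
  toMonoidHom := liftHom f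
  continuous_toFun := continuous_liftHom f.continuous

theorem lift_of {Y : Type u} {G : Type v} [TopologicalSpace Y] [Group G]
    [TopologicalSpace G] [IsTopologicalGroup G] (f : C(Y, G)) (y : Y) : lift f (of y) = f y :=
  liftHom_of f y

theorem hom_ext {Y : Type u} {G : Type v} [Group G] {φ ψ : FreeTopGroup Y →* G}
    (h : ∀ y, φ (of y) = ψ (of y)) : φ = ψ :=
  FreeGroup.ext_hom _ _ h

/-- `F_M` on morphisms: the continuous homomorphism `F_M(Y) → F_M(Z)` induced by `Y → Z`. -/
def map {Y : Type u} {Z : Type v} [TopologicalSpace Y] [TopologicalSpace Z] (f : C(Y, Z)) :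
    FreeTopGroup Y →ₜ* FreeTopGroup Z :=
  lift ⟨fun y => of (f y), continuous_of.comp f.continuous⟩

end FreeTopGroup

/-! ### The reflection `τ` from groups with topology to topological groups -/

/-- For a group `G` with a topology (not assumed compatible with the operations), `τ(G)` is the
group `G` with the quotient topology along the multiplication map `m_G : F_M(G) → G`. -/
def Tau (G : Type u) : Type u := G

namespace Tau

instance (G : Type u) [Group G] : Group (Tau G) := inferInstanceAs (Group G)

/-- The identity homomorphism `r_G : G → τ(G)`. -/
def refl (G : Type u) [Group G] : G ≃* Tau G := MulEquiv.refl G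

/-- The multiplication homomorphism `m_G : F_M(G) → τ(G)`, extending the identity. -/
def mult (G : Type u) [Group G] : FreeTopGroup G →* Tau G := FreeTopGroup.liftHom (refl G)

instance (G : Type u) [Group G] [TopologicalSpace G] : TopologicalSpace (Tau G) :=
  TopologicalSpace.coinduced (mult G) inferInstance

theorem mult_surjective (G : Type u) [Group G] : Function.Surjective (mult G) := fun g =>
  ⟨FreeTopGroup.of ((refl G).symm g), by simp [mult, FreeTopGroup.liftHom_of]⟩

theorem isQuotientMap_mult (G : Type u) [Group G] [TopologicalSpace G] :
    Topology.IsQuotientMap (mult G) :=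
  ⟨⟨rfl⟩, mult_surjective G⟩

theorem isOpenQuotientMap_mult (G : Type u) [Group G] [TopologicalSpace G] :
    IsOpenQuotientMap (mult G) :=
  MonoidHom.isOpenQuotientMap_of_isQuotientMap (isQuotientMap_mult G)

instance (G : Type u) [Group G] [TopologicalSpace G] : IsTopologicalGroup (Tau G) where
  continuous_mul := by
    have hq := (isOpenQuotientMap_mult G).prodMap (isOpenQuotientMap_mult G)
    refine hq.isQuotientMap.continuous_iff.2 ?_
    have h : Continuous fun p : FreeTopGroup G × FreeTopGroup G => mult G (p.1 * p.2) :=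
      (isQuotientMap_mult G).continuous.comp continuous_mul
    refine h.congr fun p => ?_
    simp
  continuous_inv := by
    refine (isQuotientMap_mult G).continuous_iff.2 ?_
    have h : Continuous fun p : FreeTopGroup G => mult G p⁻¹ :=
      (isQuotientMap_mult G).continuous.comp continuous_inv
    refine h.congr fun p => ?_
    simp

theorem continuous_refl (G : Type u) [Group G] [TopologicalSpace G] : Continuous (refl G) := by
  have h : Continuous fun g : G => mult G (FreeTopGroup.of g) :=
    (isQuotientMap_mult G).continuous.comp FreeTopGroup.continuous_of
  exact h.congr fun g => FreeTopGroup.liftHom_of _ g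

/-- `τ` on morphisms: the same homomorphism, which is continuous for the new topologies. -/
def map {G : Type u} {H : Type v} [Group G] [TopologicalSpace G] [Group H] [TopologicalSpace H]
    (f : G →ₜ* H) : Tau G →ₜ* Tau H where
  toMonoidHom := ((refl H).toMonoidHom.comp f.toMonoidHom).comp (refl G).symm.toMonoidHom
  continuous_toFun := by
    refine (isQuotientMap_mult G).continuous_iff.2 ?_
    have h : Continuous (FreeTopGroup.liftHom fun g : G => refl H (f g)) :=
      FreeTopGroup.continuous_liftHom ((continuous_refl H).comp f.continuous_toFun)
    have e : FreeTopGroup.liftHom (fun g : G => refl H (f g)) =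
        (((refl H).toMonoidHom.comp f.toMonoidHom).comp (refl G).symm.toMonoidHom).comp
          (mult G) := by
      refine FreeTopGroup.hom_ext fun g => ?_
      simp [mult, FreeTopGroup.liftHom_of]
    rw [e] at h
    exact h

end Tau

/-! ### The fundamental group with its quotient topology and its group topology -/

/-- The quasitopological fundamental group: the fundamental group with the quotient topology of the
loop space, `Path x x` with the compact-open topology. Mathlib multiplies loop classes in the order
`[α] * [β] = [β.trans α]`; inversion is a natural isomorphism, and a homeomorphism, onto the group
with the other order. -/
def PiOneQTop (X : Type u) [TopologicalSpace X] (x : X) : Type u := FundamentalGroup X x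

namespace PiOneQTop

instance (X : Type u) [TopologicalSpace X] (x : X) : Group (PiOneQTop X x) :=
  inferInstanceAs (Group (FundamentalGroup X x))

/-- The canonical map from the loop space, sending a loop to its homotopy class. -/
def mk {X : Type u} [TopologicalSpace X] {x : X} (γ : Path x x) : PiOneQTop X x :=
  FundamentalGroup.fromPath (Path.Homotopic.Quotient.mk γ)

instance (X : Type u) [TopologicalSpace X] (x : X) : TopologicalSpace (PiOneQTop X x) :=
  TopologicalSpace.coinduced (mk : Path x x → PiOneQTop X x) inferInstance

/-- The continuous homomorphism induced by a based map. -/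
def map {X : Type u} {Y : Type v} [TopologicalSpace X] [TopologicalSpace Y] {x : X} {y : Y}
    (f : C(X, Y)) (h : f x = y) : PiOneQTop X x →ₜ* PiOneQTop Y y where
  toMonoidHom := FundamentalGroup.mapOfEq f h
  continuous_toFun := by
    refine continuous_coinduced_dom.2 ?_
    subst h
    have h1 : Continuous fun γ : Path x x => mk (γ.map f.continuous) := by
      refine Continuous.comp (g := (mk : Path (f x) (f x) → PiOneQTop Y (f x)))
        continuous_coinduced_rng ?_
      refine continuous_induced_rng.2 ?_
      exact (ContinuousMap.continuous_postcomp f).comp continuous_induced_dom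
    refine h1.congr fun γ => ?_
    exact (FundamentalGroup.mapOfEq_apply f rfl
      (FundamentalGroup.fromPath (Path.Homotopic.Quotient.mk γ))).symm

end PiOneQTop

/-- The topological fundamental group `π₁^τ(X, x) = τ(π₁^qtop(X, x))`. -/
abbrev PiOneTau (X : Type u) [TopologicalSpace X] (x : X) : Type u := Tau (PiOneQTop X x)

namespace PiOneTau

/-- The class in `π₁^τ(X, x)` of a loop. -/
def mk {X : Type u} [TopologicalSpace X] {x : X} (γ : Path x x) : PiOneTau X x :=
  Tau.refl _ (PiOneQTop.mk γ)

/-- `π₁^τ` on morphisms. -/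
def map {X : Type u} {Y : Type v} [TopologicalSpace X] [TopologicalSpace Y] {x : X} {y : Y}
    (f : C(X, Y)) (h : f x = y) : PiOneTau X x →ₜ* PiOneTau Y y :=
  Tau.map (PiOneQTop.map f h)

end PiOneTau

/-! ### The path component space -/

/-- `π₀^qtop` on morphisms. On objects, the path component space is `ZerothHomotopy X`, which
carries the quotient topology of `X`. -/
def piZeroMap {X : Type u} {Y : Type v} [TopologicalSpace X] [TopologicalSpace Y] (f : C(X, Y)) :
    C(ZerothHomotopy X, ZerothHomotopy Y) where
  toFun := Quotient.map f fun _ _ h => Nonempty.map (fun γ => γ.map f.continuous) h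
  continuous_toFun :=
    ZerothHomotopy.isQuotientMap_mk.continuous_iff.2
      (ZerothHomotopy.isQuotientMap_mk.continuous.comp f.continuous)

/-! ### Reduced suspensions and generalized wedges of circles -/

/-- The subset `Z × {0, 1} ∪ {z₀} × I` of `Z × I`, which the reduced suspension collapses. -/
def suspensionSet (Z : Type u) (z₀ : Z) : Set (Z × I) := {p | p.2 = 0 ∨ p.2 = 1 ∨ p.1 = z₀}

/-- The equivalence relation on `Z × I` that collapses `suspensionSet Z z₀` to a point. -/
def suspensionSetoid (Z : Type u) (z₀ : Z) : Setoid (Z × I) where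
  r p q := p = q ∨ (p ∈ suspensionSet Z z₀ ∧ q ∈ suspensionSet Z z₀)
  iseqv :=
    { refl := fun _ => Or.inl rfl
      symm := by
        rintro p q (h | ⟨h, h'⟩)
        · exact Or.inl h.symm
        · exact Or.inr ⟨h', h⟩
      trans := by
        rintro p q r (rfl | ⟨h, h'⟩) (rfl | ⟨k, k'⟩)
        · exact Or.inl rfl
        · exact Or.inr ⟨k, k'⟩
        · exact Or.inr ⟨h, h'⟩
        · exact Or.inr ⟨h, k'⟩ }

/-- The reduced suspension `Σ Z` of a based space `(Z, z₀)`. -/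
def Suspension (Z : Type u) (z₀ : Z) : Type u := Quotient (suspensionSetoid Z z₀)

namespace Suspension

/-- The image `z ∧ t` of `(z, t)` in the reduced suspension. -/
def mk {Z : Type u} (z₀ : Z) (p : Z × I) : Suspension Z z₀ :=
  Quotient.mk (suspensionSetoid Z z₀) p

instance (Z : Type u) [TopologicalSpace Z] (z₀ : Z) : TopologicalSpace (Suspension Z z₀) :=
  TopologicalSpace.coinduced (mk z₀) inferInstance

theorem continuous_mk {Z : Type u} [TopologicalSpace Z] (z₀ : Z) : Continuous (mk z₀) :=
  continuous_coinduced_rng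

/-- The basepoint of the reduced suspension. -/
def base {Z : Type u} (z₀ : Z) : Suspension Z z₀ := mk z₀ (z₀, 0)

theorem mk_eq_base {Z : Type u} {z₀ : Z} {p : Z × I} (h : p ∈ suspensionSet Z z₀) :
    mk z₀ p = base z₀ :=
  Quotient.sound (s := suspensionSetoid Z z₀) (Or.inr ⟨h, Or.inl rfl⟩)

/-- The map of reduced suspensions induced by a based map, `z ∧ t ↦ f z ∧ t`. -/
def map {Z : Type u} {W : Type v} [TopologicalSpace Z] [TopologicalSpace W] {z₀ : Z} {w₀ : W}
    (f : C(Z, W)) (h : f z₀ = w₀) : C(Suspension Z z₀, Suspension W w₀) where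
  toFun := Quotient.lift (s := suspensionSetoid Z z₀) (fun p => mk w₀ (f p.1, p.2)) (by
    have key : ∀ p ∈ suspensionSet Z z₀, mk w₀ (f p.1, p.2) = base w₀ := by
      intro p hp
      refine mk_eq_base ?_
      rcases hp with hp | hp | hp
      · exact Or.inl hp
      · exact Or.inr (Or.inl hp)
      · exact Or.inr (Or.inr (by rw [← h, ← hp]))
    rintro p q (rfl | ⟨hp, hq⟩)
    · rfl
    · exact (key p hp).trans (key q hq).symm)
  continuous_toFun := by
    refine continuous_coinduced_dom.2 ?_
    exact (continuous_mk w₀).comp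
      ((f.continuous.comp continuous_fst).prodMk continuous_snd)

theorem map_base {Z : Type u} {W : Type v} [TopologicalSpace Z] [TopologicalSpace W] {z₀ : Z}
    {w₀ : W} (f : C(Z, W)) (h : f z₀ = w₀) : map f h (base z₀) = base w₀ := by
  subst h
  rfl

end Suspension

/-- The based space `X₊`: `X` with an isolated basepoint `Sum.inr PUnit.unit` added. -/
abbrev Plus (X : Type u) : Type u := X ⊕ PUnit.{u + 1}

/-- The basepoint of `X₊`. -/
abbrev Plus.pt (X : Type u) : Plus X := Sum.inr PUnit.unit

/-- The based map `f₊ : X₊ → Y₊` induced by `f : X → Y`. -/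
def Plus.map {X : Type u} {Y : Type v} [TopologicalSpace X] [TopologicalSpace Y] (f : C(X, Y)) :
    C(Plus X, Plus Y) where
  toFun := Sum.map f fun _ => PUnit.unit
  continuous_toFun := f.continuous.sumMap continuous_const

/-- The generalized wedge of circles `Σ(X₊)` on an unbased space `X`. -/
abbrev GenWedge (X : Type u) : Type u := Suspension (Plus X) (Plus.pt X)

namespace GenWedge

/-- The basepoint of `Σ(X₊)`. -/
abbrev base (X : Type u) : GenWedge X := Suspension.base (Plus.pt X)

/-- The map `Σ(f₊)`. -/
def map {X : Type u} {Y : Type v} [TopologicalSpace X] [TopologicalSpace Y] (f : C(X, Y)) :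
    C(GenWedge X, GenWedge Y) :=
  Suspension.map (Plus.map f) rfl

theorem map_base {X : Type u} {Y : Type v} [TopologicalSpace X] [TopologicalSpace Y]
    (f : C(X, Y)) : map f (base X) = base Y :=
  Suspension.map_base _ _

/-- The loop `u_x(t) = x ∧ t` in `Σ(X₊)`. -/
def loop {X : Type u} [TopologicalSpace X] (x : X) : Path (base X) (base X) where
  toFun t := Suspension.mk (Plus.pt X) (Sum.inl x, t)
  continuous_toFun := (Suspension.continuous_mk _).comp (continuous_const.prodMk continuous_id)
  source' := Suspension.mk_eq_base (Or.inl rfl)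
  target' := Suspension.mk_eq_base (Or.inr (Or.inl rfl))

end GenWedge

end TopPiOne

end

/-! The map `[x] ↦ [u_x]` is continuous into a topological group, so it extends to a continuous
homomorphism `F_M(π₀ X) → π₁^τ(Σ(X₊))`. The inverse is a holonomy homomorphism, and its continuity
is what needs work, since `X` carries no local hypotheses.

Cover `Σ(X₊)` by the open cell `U = X × (0, 1)` and a neighbourhood `V` of the basepoint that avoids
`t = 1/2`. The overlap splits into a lower and an upper part. For `φ : π₀ X → G`, take the
transition function `1` on the lower part and `φ[x]⁻¹` on the upper part. It is constant along paths
in the overlap, so it has a parallel transport along paths. The holonomy is multiplicative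
(`hol_trans`), invariant under homotopy (`hol_congr`), and sends `u_x` to `φ[x]` (`hol_loop`). If
`φ` is continuous into a topological group, holonomy is continuous on the loop space
(`continuous_hol`), hence on `π₁^qtop`, hence on `π₁^τ`.

For `φ = σ`, holonomy is a left inverse of the extension, which is therefore injective. It is
surjective because the `u_x` generate the fundamental group (`mk_mem_of_loop_mem`): `V` contracts to
the basepoint and `U` slides down to it, so a loop can be followed in small pieces inside `U` or
`V`. Naturality is checked on generators. -/

section

open Set Filter Topology

/-! ### Transport functions of a two-chart cocycle -/

section Transport

variable {S G : Type*} [TopologicalSpace S] [Group G]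

/-- A transport function on `A` for the cocycle `g` on the cover `U, V`: a function that is locally
constant on `V` and such that `g * F` is locally constant on `U`. -/
def IsTransportOn (U V : Set S) (g : S → G) (A : Set S) (F : S → G) : Prop :=
  ∀ s ∈ A, (s ∈ V → ∀ᶠ s' in 𝓝[A] s, F s' = F s) ∧
    (s ∈ U → ∀ᶠ s' in 𝓝[A] s, g s' * F s' = g s * F s)

theorem IsPreconnected.eq_of_eventually_eq {T : Type*} {A : Set S} (hA : IsPreconnected A)
    {f : S → T} (hf : ∀ s ∈ A, ∀ᶠ s' in 𝓝[A] s, f s' = f s) {s t : S} (hs : s ∈ A) (ht : t ∈ A) :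
    f s = f t := by
  let _ : TopologicalSpace T := ⊥
  have : DiscreteTopology T := ⟨rfl⟩
  refine hA.constant (f := f) (fun a ha => ?_) hs ht
  rw [ContinuousWithinAt, nhds_discrete, tendsto_pure]
  exact hf a ha

namespace IsTransportOn

variable {U V : Set S} {g : S → G} {A B : Set S} {F F' : S → G}

theorem mono (h : IsTransportOn U V g A F) (hBA : B ⊆ A) : IsTransportOn U V g B F :=
  fun s hs => ⟨fun hV => nhdsWithin_mono s hBA ((h s (hBA hs)).1 hV),
    fun hU => nhdsWithin_mono s hBA ((h s (hBA hs)).2 hU)⟩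

theorem mul_right (h : IsTransportOn U V g A F) (k : G) :
    IsTransportOn U V g A fun s => F s * k := fun s hs =>
  ⟨fun hV => ((h s hs).1 hV).mono fun s' hs' => by simp only [hs'],
    fun hU => ((h s hs).2 hU).mono fun s' hs' => by simp only [← mul_assoc, hs']⟩

theorem congr (h : IsTransportOn U V g A F) (hFF' : ∀ s ∈ A, F' s = F s) :
    IsTransportOn U V g A F' := fun s hs =>
  ⟨fun hV => by
      filter_upwards [(h s hs).1 hV, self_mem_nhdsWithin] with s' h1 h2
      rw [hFF' s hs, hFF' s' h2, h1],
    fun hU => by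
      filter_upwards [(h s hs).2 hU, self_mem_nhdsWithin] with s' h1 h2
      rw [hFF' s hs, hFF' s' h2, h1]⟩

theorem comp {R : Type*} [TopologicalSpace R] (h : IsTransportOn U V g A F) {φ : R → S}
    (hφ : Continuous φ) : IsTransportOn (φ ⁻¹' U) (φ ⁻¹' V) (g ∘ φ) (φ ⁻¹' A) (F ∘ φ) := fun r hr =>
  have ht : Tendsto φ (𝓝[φ ⁻¹' A] r) (𝓝[A] (φ r)) :=
    hφ.continuousWithinAt.tendsto_nhdsWithin (mapsTo_preimage φ A)
  ⟨fun hV => ht.eventually ((h (φ r) hr).1 hV), fun hU => ht.eventually ((h (φ r) hr).2 hU)⟩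

theorem eq_of_subset_right (h : IsTransportOn U V g A F) (hA : IsPreconnected A) (hV : A ⊆ V)
    {s t : S} (hs : s ∈ A) (ht : t ∈ A) : F s = F t :=
  hA.eq_of_eventually_eq (fun a ha => (h a ha).1 (hV ha)) hs ht

theorem eq_of_subset_left (h : IsTransportOn U V g A F) (hA : IsPreconnected A) (hU : A ⊆ U)
    {s t : S} (hs : s ∈ A) (ht : t ∈ A) : g s * F s = g t * F t :=
  hA.eq_of_eventually_eq (f := fun s => g s * F s) (fun a ha => (h a ha).2 (hU ha)) hs ht

/-- The cocycle acts on the left, so it cancels in `F⁻¹ * F' = (g * F)⁻¹ * (g * F')`. Transport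
functions are thus unique up to a constant right factor. -/
theorem inv_mul_eq (h : IsTransportOn U V g A F) (h' : IsTransportOn U V g A F')
    (hcov : ∀ s, s ∈ U ∨ s ∈ V) (hA : IsPreconnected A) {s t : S} (hs : s ∈ A) (ht : t ∈ A) :
    (F s)⁻¹ * F' s = (F t)⁻¹ * F' t := by
  refine hA.eq_of_eventually_eq (f := fun s => (F s)⁻¹ * F' s) (fun a ha => ?_) hs ht
  rcases hcov a with hU | hV
  · filter_upwards [(h a ha).2 hU, (h' a ha).2 hU] with b h1 h2
    calc (F b)⁻¹ * F' b = (g b * F b)⁻¹ * (g b * F' b) := by group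
      _ = (F a)⁻¹ * F' a := by rw [h1, h2]; group
  · filter_upwards [(h a ha).1 hV, (h' a ha).1 hV] with b h1 h2
    rw [h1, h2]

theorem union (hA : IsClosed A) (hB : IsClosed B) (h : IsTransportOn U V g A F)
    (h' : IsTransportOn U V g B F) : IsTransportOn U V g (A ∪ B) F := by
  -- Off a closed set `C` the filter `𝓝[C] s` is trivial, so the conditions extend to all `s` and
  -- the two pieces can be tested separately.
  have key : ∀ {C : Set S}, IsClosed C → IsTransportOn U V g C F → ∀ s,
      (s ∈ V → ∀ᶠ s' in 𝓝[C] s, F s' = F s) ∧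
        (s ∈ U → ∀ᶠ s' in 𝓝[C] s, g s' * F s' = g s * F s) := by
    intro C hC hF s
    by_cases hs : s ∈ C
    · exact hF s hs
    · rw [notMem_closure_iff_nhdsWithin_eq_bot.1 (by rwa [hC.closure_eq])]
      exact ⟨fun _ => eventually_bot, fun _ => eventually_bot⟩
  intro s _
  rw [nhdsWithin_union]
  exact ⟨fun hV => eventually_sup.2 ⟨(key hA h s).1 hV, (key hB h' s).1 hV⟩,
    fun hU => eventually_sup.2 ⟨(key hA h s).2 hU, (key hB h' s).2 hU⟩⟩

/-- On the connected intersection the two functions differ by one right factor `k`; correcting `F'`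
by `k` makes them agree there. -/
theorem exists_union (hcov : ∀ s, s ∈ U ∨ s ∈ V) (hA : IsClosed A) (hB : IsClosed B)
    (hAB : IsPreconnected (A ∩ B)) (h : ∃ F, IsTransportOn U V g A F)
    (h' : ∃ F, IsTransportOn U V g B F) : ∃ F, IsTransportOn U V g (A ∪ B) F := by
  classical
  obtain ⟨F, hF⟩ := h
  obtain ⟨F', hF'⟩ := h'
  obtain ⟨k, hk⟩ : ∃ k : G, ∀ s ∈ A ∩ B, F' s * k = F s := by
    rcases (A ∩ B).eq_empty_or_nonempty with he | ⟨s₀, hs₀⟩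
    · exact ⟨1, by simp [he]⟩
    · refine ⟨(F' s₀)⁻¹ * F s₀, fun s hs => ?_⟩
      rw [← (hF'.mono inter_subset_right).inv_mul_eq (hF.mono inter_subset_left) hcov hAB hs hs₀]
      group
  refine ⟨A.piecewise F fun s => F' s * k, union hA hB ?_ ?_⟩
  · exact hF.congr fun s hs => by simp [hs]
  · refine (hF'.mul_right k).congr fun s hs => ?_
    by_cases hsA : s ∈ A
    · simp [hsA, hk s ⟨hsA, hs⟩]
    · simp [hsA]

/-- Inside one chart an explicit solution exists: `g⁻¹` in `U`, `1` in `V`. -/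
theorem exists_of_subset (hg : ∀ s ∈ U ∩ V, ∀ᶠ s' in 𝓝 s, g s' = g s) (hA : A ⊆ U ∨ A ⊆ V) :
    ∃ F, IsTransportOn U V g A F := by
  rcases hA with hA | hA
  · refine ⟨fun s => (g s)⁻¹, fun s hs => ⟨fun hV => ?_, fun _ => by simp⟩⟩
    exact nhdsWithin_le_nhds ((hg s ⟨hA hs, hV⟩).mono fun s' hs' => by simp only [hs'])
  · refine ⟨fun s => 1, fun s hs => ⟨fun _ => by simp, fun hU => ?_⟩⟩
    exact nhdsWithin_le_nhds ((hg s ⟨hU, hA hs⟩).mono fun s' hs' => by simp only [hs'])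

/-- A Lebesgue subdivision gives rectangles each inside one chart. They are glued into rows along
vertical edges and the rows along horizontal segments, so every intersection is connected. -/
theorem exists_square {U V : Set (I × I)} {g : I × I → G} (hU : IsOpen U) (hV : IsOpen V)
    (hcov : ∀ s, s ∈ U ∨ s ∈ V) (hg : ∀ s ∈ U ∩ V, ∀ᶠ s' in 𝓝 s, g s' = g s) :
    ∃ F, IsTransportOn U V g univ F := by
  obtain ⟨t, ht0, htm, ⟨n, hn⟩, ht⟩ :=
    exists_monotone_Icc_subset_open_cover_unitInterval_prod_self
      (c := fun b : Bool => cond b U V) (by rintro (_ | _) <;> assumption)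
      (fun s _ => mem_iUnion.2 ((hcov s).elim (fun h => ⟨true, h⟩) fun h => ⟨false, h⟩))
  have small : ∀ k m, ∃ F, IsTransportOn U V g (Icc (t k) (t (k + 1)) ×ˢ Icc (t m) (t (m + 1))) F := by
    intro k m
    obtain ⟨b, hb⟩ := ht k m
    exact exists_of_subset hg (by cases b; exacts [Or.inr hb, Or.inl hb])
  have split : ∀ k, Icc 0 (t (k + 1)) = Icc 0 (t k) ∪ Icc (t k) (t (k + 1)) := fun k =>
    (Icc_union_Icc_eq_Icc bot_le (htm k.le_succ)).symm
  have inter : ∀ k, Icc 0 (t k) ∩ Icc (t k) (t (k + 1)) = {t k} := fun k =>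
    Icc_inter_Icc_eq_singleton bot_le (htm k.le_succ)
  have row : ∀ m k, ∃ F, IsTransportOn U V g (Icc 0 (t k) ×ˢ Icc (t m) (t (m + 1))) F := by
    intro m k
    induction k with
    | zero =>
      obtain ⟨F, hF⟩ := small 0 m
      -- Since `t 0 = 0`, the empty row is the degenerate left edge of its first rectangle.
      refine ⟨F, hF.mono (prod_mono (Icc_subset_Icc ht0.le (htm (Nat.zero_le _))) subset_rfl)⟩
    | succ k ih =>
      rw [split, union_prod]
      refine exists_union hcov (isClosed_Icc.prod isClosed_Icc) (isClosed_Icc.prod isClosed_Icc)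
        ?_ ih (small k m)
      rw [prod_inter_prod, inter, inter_self]
      exact isPreconnected_singleton.prod isPreconnected_Icc
  have col : ∀ m, ∃ F, IsTransportOn U V g (Icc 0 (t n) ×ˢ Icc 0 (t m)) F := by
    intro m
    induction m with
    | zero =>
      obtain ⟨F, hF⟩ := row 0 n
      refine ⟨F, hF.mono (prod_mono subset_rfl (Icc_subset_Icc ht0.le (htm (Nat.zero_le _))))⟩
    | succ m ih =>
      rw [split, prod_union]
      refine exists_union hcov (isClosed_Icc.prod isClosed_Icc) (isClosed_Icc.prod isClosed_Icc)
        ?_ ih (row m n)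
      rw [prod_inter_prod, inter, inter_self]
      exact isPreconnected_Icc.prod isPreconnected_singleton
  obtain ⟨F, hF⟩ := col n
  refine ⟨F, hF.mono fun s _ => ?_⟩
  rw [hn n le_rfl]
  exact ⟨⟨bot_le, le_top⟩, ⟨bot_le, le_top⟩⟩

end IsTransportOn

end Transport

/-! ### Holonomy of a two-chart cocycle along paths -/

instance unitInterval.locallyPathConnectedSpace : LocallyPathConnectedSpace I :=
  (convex_Icc (0 : ℝ) 1).locallyPathConnectedSpace

/-- A cover of `Z` by two open sets with a `G`-valued transition function that is constant along
paths in the overlap. -/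
structure PathCocycle (Z : Type*) [TopologicalSpace Z] (G : Type*) where
  /-- The first chart. -/
  U : Set Z
  /-- The second chart. -/
  V : Set Z
  /-- The transition function. -/
  g : Z → G
  isOpen_U : IsOpen U
  isOpen_V : IsOpen V
  cover : ∀ z, z ∈ U ∨ z ∈ V
  map_eq : ∀ {p q : Z} (γ : Path p q), (∀ i, γ i ∈ U ∩ V) → g p = g q

namespace PathCocycle

variable {Z G : Type*} [TopologicalSpace Z] (c : PathCocycle Z G)

/-- Constancy along paths becomes local constancy after pulling back to a locally path connected
source. This is why `Z` itself needs no local hypothesis. -/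
theorem eventually_map_eq {S : Type*} [TopologicalSpace S] [LocallyPathConnectedSpace S]
    (H : C(S, Z)) {s : S} (hs : H s ∈ c.U ∩ c.V) : ∀ᶠ s' in 𝓝 s, c.g (H s') = c.g (H s) := by
  have hW : H ⁻¹' (c.U ∩ c.V) ∈ 𝓝 s :=
    ((c.isOpen_U.inter c.isOpen_V).preimage H.continuous).mem_nhds hs
  obtain ⟨W, ⟨hW1, hW2⟩, hW3⟩ := (path_connected_basis s).mem_iff.1 hW
  filter_upwards [hW1] with s' hs'
  obtain ⟨γ, hγ⟩ := hW2.joinedIn s' hs' s (mem_of_mem_nhds hW1)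
  exact c.map_eq (γ.map H.continuous) fun i => hW3 (hγ i)

variable [Group G]

/-- A transport function along a map `H : S → Z`. -/
def IsTransport {S : Type*} [TopologicalSpace S] (H : S → Z) (F : S → G) : Prop :=
  IsTransportOn (H ⁻¹' c.U) (H ⁻¹' c.V) (c.g ∘ H) univ F

variable {c} in
theorem IsTransport.comp {R S : Type*} [TopologicalSpace R] [TopologicalSpace S] {H : S → Z}
    {F : S → G} (h : c.IsTransport H F) {φ : R → S} (hφ : Continuous φ) :
    c.IsTransport (H ∘ φ) (F ∘ φ) :=
  IsTransportOn.comp h hφ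

theorem exists_isTransport_square (H : C(I × I, Z)) : ∃ F, c.IsTransport H F :=
  IsTransportOn.exists_square (c.isOpen_U.preimage H.continuous) (c.isOpen_V.preimage H.continuous)
    (fun s => c.cover (H s)) fun _ hs => c.eventually_map_eq H hs

theorem exists_isTransport (H : C(I, Z)) : ∃ F, c.IsTransport H F := by
  obtain ⟨F, hF⟩ := c.exists_isTransport_square (H.comp ⟨Prod.snd, continuous_snd⟩)
  exact ⟨_, hF.comp (φ := fun t : I => ((0 : I), t)) (by fun_prop)⟩

/-- The holonomy of a path. -/
noncomputable def hol {p q : Z} (γ : Path p q) : G :=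
  (c.exists_isTransport γ.toContinuousMap).choose 1 *
    ((c.exists_isTransport γ.toContinuousMap).choose 0)⁻¹

/-- A right factor cancels in `F 1 * (F 0)⁻¹`, so the choice of transport function is immaterial. -/
theorem hol_eq {p q : Z} (γ : Path p q) {F : I → G} (hF : c.IsTransport γ F) :
    c.hol γ = F 1 * (F 0)⁻¹ := by
  have h := IsTransportOn.inv_mul_eq hF (c.exists_isTransport γ.toContinuousMap).choose_spec
    (fun s => c.cover (γ s)) isPreconnected_univ (mem_univ (1 : I)) (mem_univ (0 : I))
  rw [hol, mul_inv_eq_iff_eq_mul, mul_assoc, ← h]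
  group

theorem hol_trans {p q r : Z} (γ : Path p q) (δ : Path q r) :
    c.hol (γ.trans δ) = c.hol δ * c.hol γ := by
  obtain ⟨F, hF⟩ := c.exists_isTransport (γ.trans δ).toContinuousMap
  let φ : I → I := fun t => ⟨(t : ℝ) / 2, by constructor <;> linarith [t.2.1, t.2.2]⟩
  let ψ : I → I := fun t => ⟨(1 + t : ℝ) / 2, by constructor <;> linarith [t.2.1, t.2.2]⟩
  have hφ : (γ.trans δ) ∘ φ = γ := by
    funext t
    have : (t : ℝ) / 2 ≤ 1 / 2 := by linarith [t.2.2]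
    simp only [Function.comp_apply, Path.trans_apply, φ, this, dif_pos]
    congr 1
    ext
    simp; ring
  have hψ : (γ.trans δ) ∘ ψ = δ := by
    funext t
    rcases eq_or_ne t 0 with rfl | h0
    · simp [Path.trans_apply, ψ]
    have : ¬ (1 + t : ℝ) / 2 ≤ 1 / 2 := by
      have : 0 < (t : ℝ) := unitInterval.pos_iff_ne_zero.2 h0
      linarith
    simp only [Function.comp_apply, Path.trans_apply, ψ, this, dif_neg, not_false_eq_true]
    congr 1
    ext
    simp; ring
  have h1 : c.IsTransport γ (F ∘ φ) := hφ ▸ IsTransport.comp hF (by fun_prop)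
  have h2 : c.IsTransport δ (F ∘ ψ) := hψ ▸ IsTransport.comp hF (by fun_prop)
  have e0 : φ 0 = 0 := by ext; simp [φ]
  have e1 : φ 1 = ψ 0 := by ext; simp [φ, ψ]
  have e2 : ψ 1 = 1 := by ext; simp [ψ]
  rw [c.hol_eq _ hF, c.hol_eq _ h1, c.hol_eq _ h2]
  simp only [Function.comp_apply, e0, e1, e2]
  group

/-- Transport over the homotopy square is constant on the two sides where the endpoints stay fixed,
because these map into `V`, where `F` itself is locally constant. -/
theorem hol_congr {p q : Z} (hp : p ∈ c.V) (hq : q ∈ c.V) {γ δ : Path p q}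
    (h : γ.Homotopic δ) : c.hol γ = c.hol δ := by
  obtain ⟨H⟩ := h
  obtain ⟨F, hF⟩ := c.exists_isTransport_square H.toContinuousMap
  have h0 : c.IsTransport γ fun t => F (0, t) := by
    have := hF.comp (φ := fun t : I => ((0 : I), t)) (by fun_prop)
    have e : ⇑H.toContinuousMap ∘ (fun t : I => ((0 : I), t)) = γ := funext H.apply_zero
    exact e ▸ this
  have h1 : c.IsTransport δ fun t => F (1, t) := by
    have := hF.comp (φ := fun t : I => ((1 : I), t)) (by fun_prop)
    have e : ⇑H.toContinuousMap ∘ (fun t : I => ((1 : I), t)) = δ := funext H.apply_one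
    exact e ▸ this
  have hside : ∀ a : I, (∀ s, H (s, a) ∈ c.V) → F (0, a) = F (1, a) := fun a ha =>
    IsTransportOn.eq_of_subset_right (hF.comp (φ := fun s : I => (s, a)) (by fun_prop))
      isPreconnected_univ (fun s _ => ha s) (mem_univ (0 : I)) (mem_univ (1 : I))
  rw [c.hol_eq _ h0, c.hol_eq _ h1, hside 0 fun s => by rwa [H.source],
    hside 1 fun s => by rwa [H.target]]

/-- Normalise transport to be `1` at time `0` and let continuity at `γ` of its value at time `s`,
read in either chart, propagate from `s = 0` to `s = 1`. -/
theorem continuous_hol [TopologicalSpace G] [IsTopologicalGroup G] {p q : Z} (hp : p ∈ c.V)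
    (hq : q ∈ c.V) (hg : ∀ z ∈ c.U ∩ c.V, ContinuousAt c.g z) :
    Continuous (c.hol : Path p q → G) := by
  refine continuous_iff_continuousAt.2 fun γ => ?_
  choose F hF using fun δ : Path p q => c.exists_isTransport δ.toContinuousMap
  let N : Path p q → I → G := fun δ s => F δ s * (F δ 0)⁻¹
  have hN : ∀ δ : Path p q, c.IsTransport δ (N δ) := fun δ => (hF δ).mul_right _
  have heval : ∀ s, Continuous fun δ : Path p q => δ s := fun s =>
    (continuous_eval_const (F := C(I, Z)) s).comp
      (continuous_induced_dom (f := (Path.toContinuousMap : Path p q → C(I, Z))))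
  -- On the overlap the two readings are equivalent, since they differ by the factor `c.g (δ s)`,
  -- which is continuous in `δ` at `γ`.
  let P : I → Prop := fun s => (γ s ∈ c.V → ContinuousAt (fun δ => N δ s) γ) ∧
    (γ s ∈ c.U → ContinuousAt (fun δ => c.g (δ s) * N δ s) γ)
  have hgs : ∀ s, γ s ∈ c.U → γ s ∈ c.V → ContinuousAt (fun δ : Path p q => c.g (δ s)) γ :=
    fun s hU hV => ContinuousAt.comp (f := fun δ : Path p q => δ s) (hg _ ⟨hU, hV⟩)
      (heval s).continuousAt
  have hPV : ∀ s, γ s ∈ c.V → (P s ↔ ContinuousAt (fun δ => N δ s) γ) := fun s hV =>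
    ⟨fun h => h.1 hV, fun h => ⟨fun _ => h, fun hU => (hgs s hU hV).mul h⟩⟩
  have hPU : ∀ s, γ s ∈ c.U → (P s ↔ ContinuousAt (fun δ => c.g (δ s) * N δ s) γ) := fun s hU =>
    ⟨fun h => h.2 hU, fun h => ⟨fun hV => ((hgs s hU hV).inv.mul h).congr
      (Eventually.of_forall fun δ => inv_mul_cancel_left _ _), fun _ => h⟩⟩
  have hnear : ∀ {W : Set Z}, IsOpen W → ∀ s, γ s ∈ W → ∃ C ∈ 𝓝 s, IsPreconnected C ∧ s ∈ C ∧
      (∀ t ∈ C, γ t ∈ W) ∧ ∀ᶠ δ : Path p q in 𝓝 γ, ∀ t ∈ C, δ t ∈ W := by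
    intro W hW s hs
    obtain ⟨a, b, hs', hab, hsub⟩ := exists_Icc_mem_subset_of_mem_nhds
      ((hW.preimage γ.continuous).mem_nhds hs)
    refine ⟨Icc a b, hab, isPreconnected_Icc, hs', fun t ht => hsub ht, ?_⟩
    have := (ContinuousMap.isOpen_setOfPred_mapsTo (isCompact_Icc (a := a) (b := b)) hW).preimage
      (continuous_induced_dom (f := (Path.toContinuousMap : Path p q → C(I, Z))))
    exact this.mem_nhds fun t ht => hsub ht
  -- If `γ` maps a compact interval `C` into one chart, so does every nearby `δ`. The value in that
  -- chart is then constant in time on `C`, so continuity at one time of `C` is continuity at any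
  -- other.
  have hloc : IsLocallyConstant P := by
    rw [IsLocallyConstant.iff_eventually_eq]
    intro s
    rcases c.cover (γ s) with hU | hV
    · obtain ⟨C, hC, hCc, hsC, hγC, hδC⟩ := hnear c.isOpen_U s hU
      filter_upwards [hC] with t ht
      rw [eq_iff_iff, hPU s hU, hPU t (hγC t ht)]
      refine continuousAt_congr ?_
      filter_upwards [hδC] with δ hδ
      exact IsTransportOn.eq_of_subset_left ((hN δ).mono (subset_univ C)) hCc hδ ht hsC
    · obtain ⟨C, hC, hCc, hsC, hγC, hδC⟩ := hnear c.isOpen_V s hV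
      filter_upwards [hC] with t ht
      rw [eq_iff_iff, hPV s hV, hPV t (hγC t ht)]
      refine continuousAt_congr ?_
      filter_upwards [hδC] with δ hδ
      exact IsTransportOn.eq_of_subset_right ((hN δ).mono (subset_univ C)) hCc hδ ht hsC
  have h0 : P 0 := by
    rw [hPV 0 (by simpa using hp)]
    simp only [N, mul_inv_cancel]
    exact continuousAt_const
  have h1 : P 1 := by
    rwa [hloc.apply_eq_of_preconnectedSpace 1 0]
  refine ((hPV 1 (by simpa using hq)).1 h1).congr (Eventually.of_forall fun δ => ?_)
  exact (c.hol_eq δ (hF δ)).symm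

end PathCocycle

/-! ### Homotopies of paths through simply connected spaces -/

instance unitInterval.contractibleSpace : ContractibleSpace I :=
  (convex_Icc (0 : ℝ) 1).contractibleSpace ⟨0, unitInterval.zero_mem⟩

/-- Two paths that are images of paths with common endpoints in a simply connected space are
homotopic. -/
theorem Path.Homotopic.of_simplyConnectedSpace {S Z : Type*} [TopologicalSpace S]
    [TopologicalSpace Z] [SimplyConnectedSpace S] {f : S → Z} (hf : Continuous f) {a b : S} {p q : Z}
    {γ δ : Path p q} (γ' δ' : Path a b) (hγ : ∀ t, γ t = f (γ' t)) (hδ : ∀ t, δ t = f (δ' t)) :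
    γ.Homotopic δ := by
  obtain rfl : f a = p := by rw [← γ.source, hγ, γ'.source]
  obtain rfl : f b = q := by rw [← γ.target, hγ, γ'.target]
  have h1 : γ = γ'.map hf := Path.ext (funext hγ)
  have h2 : δ = δ'.map hf := Path.ext (funext hδ)
  rw [h1, h2]
  exact (SimplyConnectedSpace.paths_homotopic γ' δ').map ⟨f, hf⟩

/-- A square whose top side is constant gives a homotopy between its other sides. -/
theorem Path.Homotopic.trans_of_square {Z : Type*} [TopologicalSpace Z] {Q : I × I → Z}
    (hQ : Continuous Q) {p q r : Z} {α : Path p q} {κ : Path p r} {μ : Path q r}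
    (hα : ∀ j, α j = Q (j, 0)) (hκ : ∀ t, κ t = Q (0, t)) (hμ : ∀ t, μ t = Q (1, t))
    (htop : ∀ j, Q (j, 1) = r) : (α.trans μ).Homotopic κ := by
  let id' : Path (0 : I) 1 := ⟨⟨id, continuous_id⟩, rfl, rfl⟩
  -- These are the images of the two ways around the square from `(0, 0)` to `(1, 1)`; the top side
  -- contributes the constant path.
  have h : (α.trans μ).Homotopic (κ.trans (Path.refl r)) := by
    refine .of_simplyConnectedSpace hQ ((id'.prod (Path.refl 0)).trans ((Path.refl 1).prod id'))
      (((Path.refl 0).prod id').trans (id'.prod (Path.refl 1))) (fun t => ?_) (fun t => ?_)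
    · simp only [Path.trans_apply]
      split_ifs
      · rw [hα]
        rfl
      · rw [hμ]; rfl
    · simp only [Path.trans_apply]
      split_ifs
      · rw [hκ]; rfl
      · exact (htop _).symm
  exact h.trans ⟨Path.Homotopy.transRefl κ⟩

noncomputable section

namespace TopPiOne

/-! ### Maps out of the reduced suspension and the contraction near its basepoint -/

namespace Suspension

variable {Z : Type*} {z₀ : Z}

theorem mk_eq_mk {p q : Z × I} :
    mk z₀ p = mk z₀ q ↔ p = q ∨ (p ∈ suspensionSet Z z₀ ∧ q ∈ suspensionSet Z z₀) :=
  Quotient.eq (r := suspensionSetoid Z z₀)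

theorem mk_surjective : Function.Surjective (mk z₀) := Quotient.mk_surjective

/-- A function on the reduced suspension from a function constant on the collapsed set. -/
def lift {W : Type*} (f : Z × I → W) (w : W) (hf : ∀ p ∈ suspensionSet Z z₀, f p = w) :
    Suspension Z z₀ → W :=
  Quotient.lift (s := suspensionSetoid Z z₀) f (by
    rintro p q (rfl | ⟨hp, hq⟩)
    · rfl
    · rw [hf p hp, hf q hq])

theorem lift_mk {W : Type*} (f : Z × I → W) (w : W) (hf : ∀ p ∈ suspensionSet Z z₀, f p = w)
    (p : Z × I) : lift f w hf (mk z₀ p) = f p := rfl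

theorem continuous_lift [TopologicalSpace Z] {W : Type*} [TopologicalSpace W] {f : Z × I → W}
    {w : W} {hf : ∀ p ∈ suspensionSet Z z₀, f p = w} (h : Continuous f) :
    Continuous (lift f w hf) :=
  continuous_coinduced_dom.2 h

/-- The homotopy `z ∧ t ↦ z ∧ (t + r (2t - 1))`, which pushes a neighbourhood of the basepoint into
the basepoint. -/
def push [TopologicalSpace Z] : Suspension Z z₀ → C(I, Suspension Z z₀) :=
  lift (fun p => ⟨fun r => mk z₀ (p.1, projIcc (0 : ℝ) 1 zero_le_one (p.2 + r * (2 * p.2 - 1))),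
      (continuous_mk z₀).comp (by fun_prop)⟩) (ContinuousMap.const I (base z₀)) (by
    rintro ⟨z, t⟩ h
    ext r
    refine mk_eq_base ?_
    rcases h with h | h | h
    · refine Or.inl ?_
      dsimp only at h ⊢
      rw [h, projIcc_eq_zero]
      simp [r.2.1]
    · refine Or.inr (Or.inl ?_)
      dsimp only at h ⊢
      rw [h, projIcc_eq_one]
      simp [r.2.1]
    · exact Or.inr (Or.inr h))

theorem push_mk [TopologicalSpace Z] (p : Z × I) (r : I) :
    push (mk z₀ p) r = mk z₀ (p.1, projIcc (0 : ℝ) 1 zero_le_one (p.2 + r * (2 * p.2 - 1))) := rfl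

/-- Currying in the time `r` makes the homotopy a map out of the quotient, so continuity is checked
on `Z × I` before collapsing. -/
theorem continuous_push [TopologicalSpace Z] :
    Continuous (push : Suspension Z z₀ → C(I, Suspension Z z₀)) := by
  refine continuous_lift (ContinuousMap.continuous_of_continuous_uncurry _ ?_)
  exact (continuous_mk z₀).comp (by fun_prop)

theorem push_zero [TopologicalSpace Z] (z : Suspension Z z₀) : push z 0 = z := by
  obtain ⟨p, rfl⟩ := mk_surjective z
  simp [push_mk]

end Suspension

/-! ### The height function and the open cell of `Σ(X₊)` -/

namespace GenWedge

open Suspension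

variable {X : Type*}

/-- The distance to the endpoints in the suspension coordinate, `x ∧ t ↦ min t (1 - t)`. -/
def height (z : GenWedge X) : ℝ :=
  lift (fun p => Sum.elim (fun _ => 1) (fun _ => 0) p.1 * min (p.2 : ℝ) (1 - p.2)) 0 (by
    rintro ⟨y, t⟩ (h | h | h) <;> dsimp only at h <;> subst h <;> simp) z

theorem height_inl (x : X) (t : I) :
    height (mk (Plus.pt X) (Sum.inl x, t)) = min (t : ℝ) (1 - t) := by
  simp [height, lift_mk]

theorem height_inr (t : I) : height (mk (Plus.pt X) (Sum.inr PUnit.unit, t)) = 0 := by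
  simp [height, lift_mk]

theorem height_base : height (base X) = 0 := height_inr 0

theorem continuous_height [TopologicalSpace X] : Continuous (height : GenWedge X → ℝ) := by
  have h : Continuous (Sum.elim (fun _ => 1) (fun _ => 0) : Plus X → ℝ) :=
    continuous_const.sumElim continuous_const
  exact continuous_coinduced_dom.2 ((h.comp continuous_fst).mul
    (by fun_prop : Continuous fun p : Plus X × I => min (p.2 : ℝ) (1 - p.2)))

/-- The part `X × (0, 1)` of `Σ(X₊)`. -/
def cell (p : X × Ioo (0 : I) 1) : GenWedge X := mk (Plus.pt X) (Sum.inl p.1, p.2)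

theorem notMem_suspensionSet (x : X) (t : Ioo (0 : I) 1) :
    ((Sum.inl x, (t : I)) : Plus X × I) ∉ suspensionSet (Plus X) (Plus.pt X) := by
  rintro (h | h | h)
  · exact t.2.1.ne' h
  · exact t.2.2.ne h
  · exact Sum.inl_ne_inr h

theorem mk_eq_cell {p : Plus X × I} {q : X × Ioo (0 : I) 1} :
    mk (Plus.pt X) p = cell q ↔ p = (Sum.inl q.1, (q.2 : I)) := by
  rw [cell, mk_eq_mk]
  exact or_iff_left fun h => notMem_suspensionSet _ _ h.2

theorem height_pos_iff {z : GenWedge X} : 0 < height z ↔ z ∈ range (cell (X := X)) := by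
  constructor
  · obtain ⟨⟨x | _, t⟩, rfl⟩ := mk_surjective z
    · rw [height_inl, lt_min_iff]
      exact fun h =>
        ⟨(x, ⟨t, h.1, Subtype.coe_lt_coe.1 (by simpa using h.2)⟩), rfl⟩
    · rw [height_inr]
      exact fun h => absurd h (lt_irrefl 0)
  · rintro ⟨⟨x, t, h0, h1⟩, rfl⟩
    rw [cell, height_inl, lt_min_iff]
    have h0' : (0 : ℝ) < t := h0
    have h1' : (t : ℝ) < 1 := h1
    exact ⟨h0', by dsimp only; linarith⟩

theorem eq_base_of_mk_inl {x : X} {t : I} (h : mk (Plus.pt X) (Sum.inl x, t) = base X) :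
    t = 0 ∨ t = 1 := by
  rcases mk_eq_mk.1 h with h | h
  · exact absurd (congrArg Prod.fst h) Sum.inl_ne_inr
  · rcases h.1 with h | h | h
    · exact Or.inl h
    · exact Or.inr h
    · exact absurd h Sum.inl_ne_inr

/-- No point of the cell is identified with another, so the preimage in `X₊ × I` of the image of an
open set is just its copy there, which is open. -/
theorem isOpenEmbedding_cell [TopologicalSpace X] : IsOpenEmbedding (cell (X := X)) := by
  have hj : IsOpenEmbedding (Prod.map Sum.inl Subtype.val : X × Ioo (0 : I) 1 → Plus X × I) :=
    IsOpenEmbedding.inl.prodMap isOpen_Ioo.isOpenEmbedding_subtypeVal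
  refine .of_continuous_injective_isOpenMap ((continuous_mk _).comp hj.continuous) ?_ ?_
  · intro p q h
    exact hj.injective (mk_eq_cell.1 h)
  · intro W hW
    refine isOpen_coinduced.2 ?_
    convert hj.isOpenMap W hW using 1
    ext p
    constructor
    · rintro ⟨q, hq, h⟩
      exact ⟨q, hq, (mk_eq_cell.1 h.symm).symm⟩
    · rintro ⟨q, hq, rfl⟩
      exact ⟨q, hq, rfl⟩

theorem exists_lift_cell [TopologicalSpace X] {S : Type*} [TopologicalSpace S] {α : S → GenWedge X}
    (hα : Continuous α) (h : ∀ s, 0 < height (α s)) :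
    ∃ f : C(S, X × Ioo (0 : I) 1), ∀ s, α s = cell (f s) := by
  choose f hf using fun s => height_pos_iff.1 (h s)
  refine ⟨⟨f, isOpenEmbedding_cell.isInducing.continuous_iff.2 ?_⟩, fun s => (hf s).symm⟩
  exact hα.congr fun s => (hf s).symm

/-! ### The cocycle of `Σ(X₊)` -/

open Classical in
/-- The transition function `x ∧ t ↦ φ(x)⁻¹` for `1 / 2 < t < 1`, and `1` elsewhere. -/
def transition {G : Type*} [Group G] (φ : X → G) : GenWedge X → G :=
  lift (fun p => Sum.elim (fun x => if 1 / 2 < (p.2 : ℝ) ∧ p.2 < 1 then (φ x)⁻¹ else 1)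
    (fun _ => 1) p.1) 1 (by
    rintro ⟨_ | _, t⟩ (h | h | h)
    · simp only [Sum.elim_inl] at h ⊢
      subst h
      norm_num
    · simp only [Sum.elim_inl] at h ⊢
      subst h
      norm_num
    · exact absurd h Sum.inl_ne_inr
    all_goals rfl)

theorem transition_cell_of_lt {G : Type*} [Group G] (φ : X → G) (p : X × Ioo (0 : I) 1)
    (h : 1 / 2 < (p.2 : ℝ)) : transition φ (cell p) = (φ p.1)⁻¹ :=
  if_pos ⟨h, p.2.2.2⟩

theorem transition_cell_of_le {G : Type*} [Group G] (φ : X → G) (p : X × Ioo (0 : I) 1)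
    (h : (p.2 : ℝ) ≤ 1 / 2) : transition φ (cell p) = 1 :=
  if_neg fun h' => h.not_gt h'.1

theorem height_cell (p : X × Ioo (0 : I) 1) : height (cell p) = min (p.2 : ℝ) (1 - p.2) :=
  height_inl _ _

variable [TopologicalSpace X]

/-- The cocycle on `Σ(X₊)` whose holonomy along `u_x` is `φ [x]`. -/
def cocycle {G : Type*} [Group G] (φ : ZerothHomotopy X → G) : PathCocycle (GenWedge X) G where
  U := {z | 0 < height z}
  V := {z | height z < 1 / 3}
  g := transition fun x => φ (ZerothHomotopy.mk x)
  isOpen_U := isOpen_lt continuous_const continuous_height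
  isOpen_V := isOpen_lt continuous_height continuous_const
  cover z := (lt_or_ge 0 (height z)).imp id fun h => h.trans_lt (by norm_num)
  map_eq {p q} γ hγ := by
    obtain ⟨f, hf⟩ := exists_lift_cell γ.continuous fun i => (hγ i).1
    have hmk : ZerothHomotopy.mk (f 0).1 = ZerothHomotopy.mk (f 1).1 :=
      ZerothHomotopy.sound ⟨⟨fun i => (f i).1, by fun_prop⟩, rfl, rfl⟩
    -- Points with `t = 1/2` have height `1/2`, outside `V`. By the intermediate value theorem the
    -- path stays on one side of `1/2`, and its `X`-coordinate stays in one path component.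
    have hhalf : ∀ i, ((f i).2 : ℝ) ≠ 1 / 2 := by
      intro i hi
      have := (hγ i).2
      rw [mem_ofPred_eq, hf, height_cell, hi] at this
      norm_num at this
    have hcont : Continuous fun i => ((f i).2 : ℝ) := by fun_prop
    obtain rfl : cell (f 0) = p := (hf 0).symm.trans γ.source
    obtain rfl : cell (f 1) = q := (hf 1).symm.trans γ.target
    rcases lt_or_ge (1 / 2) ((f 0).2 : ℝ) with h0 | h0 <;>
      rcases lt_or_ge (1 / 2) ((f 1).2 : ℝ) with h1 | h1
    · rw [transition_cell_of_lt _ _ h0, transition_cell_of_lt _ _ h1, hmk]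
    · obtain ⟨i, hi⟩ := mem_range_of_exists_le_of_exists_ge hcont ⟨1, h1⟩ ⟨0, h0.le⟩
      exact absurd hi (hhalf i)
    · obtain ⟨i, hi⟩ := mem_range_of_exists_le_of_exists_ge hcont ⟨0, h0⟩ ⟨1, h1.le⟩
      exact absurd hi (hhalf i)
    · rw [transition_cell_of_le _ _ h0, transition_cell_of_le _ _ h1]

theorem cocycle_g {G : Type*} [Group G] (φ : ZerothHomotopy X → G) :
    (cocycle φ).g = transition fun x => φ (ZerothHomotopy.mk x) := rfl

theorem base_mem_cocycle_V {G : Type*} [Group G] (φ : ZerothHomotopy X → G) :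
    base X ∈ (cocycle φ).V := by
  change height (base X) < 1 / 3
  rw [height_base]
  norm_num

theorem continuousAt_cocycle_g {G : Type*} [Group G] [TopologicalSpace G] [IsTopologicalGroup G]
    {φ : ZerothHomotopy X → G} (hφ : Continuous φ) {z : GenWedge X}
    (hz : z ∈ (cocycle φ).U ∩ (cocycle φ).V) : ContinuousAt (cocycle φ).g z := by
  obtain ⟨p, rfl⟩ := height_pos_iff.1 hz.1
  rw [← isOpenEmbedding_cell.continuousAt_iff]
  have hcont : Continuous fun p : X × Ioo (0 : I) 1 => ((p.2 : I) : ℝ) := by fun_prop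
  have hV : min ((p.2 : I) : ℝ) (1 - p.2) < 1 / 3 := by rw [← height_cell]; exact hz.2
  rcases min_lt_iff.1 hV with h | h
  · refine continuousAt_const (y := (1 : G)) |>.congr ?_
    filter_upwards [hcont.continuousAt.eventually_lt_const h] with q hq
    exact (transition_cell_of_le (fun x => φ (ZerothHomotopy.mk x)) q (by linarith)).symm
  · have : Continuous fun q : X × Ioo (0 : I) 1 => (φ (ZerothHomotopy.mk q.1))⁻¹ :=
      (hφ.comp (ZerothHomotopy.isQuotientMap_mk.continuous.comp continuous_fst)).inv
    refine this.continuousAt.congr ?_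
    have h' : 2 / 3 < ((p.2 : I) : ℝ) := by linarith
    filter_upwards [hcont.continuousAt.eventually_const_lt h'] with q hq
    exact (transition_cell_of_lt (fun x => φ (ZerothHomotopy.mk x)) q (by linarith)).symm

/-- The transport function jumps from `1` to `φ[x]` at `t = 1/2`. The jump lies outside `V`, and in
`U` it is cancelled by the transition function, so that `g * F = 1`. -/
theorem hol_loop {G : Type*} [Group G] (φ : ZerothHomotopy X → G) (x : X) :
    (cocycle φ).hol (loop x) = φ (ZerothHomotopy.mk x) := by
  classical
  have hF : (cocycle φ).IsTransport (loop x)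
      fun t : I => if 1 / 2 < (t : ℝ) then φ (ZerothHomotopy.mk x) else 1 := by
    intro t _
    rw [nhdsWithin_univ]
    have hloop : ∀ s : I, loop x s = mk (Plus.pt X) (Sum.inl x, s) := fun s => rfl
    have hcont : Continuous fun s : I => (s : ℝ) := by fun_prop
    constructor
    · intro hV
      have hV' : min (t : ℝ) (1 - t) < 1 / 3 := by rw [← height_inl x]; exact hV
      rcases min_lt_iff.1 hV' with h | h
      · filter_upwards [hcont.continuousAt.eventually_lt_const h] with s hs
        rw [if_neg (by linarith), if_neg (by linarith)]
      · have h' : 2 / 3 < (t : ℝ) := by linarith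
        filter_upwards [hcont.continuousAt.eventually_const_lt h'] with s hs
        rw [if_pos (by linarith), if_pos (by linarith)]
    · intro hU
      have key : ∀ s : I, 0 < height (loop x s) → (cocycle φ).g (loop x s) *
          (if 1 / 2 < (s : ℝ) then φ (ZerothHomotopy.mk x) else 1) = 1 := by
        intro s hs
        obtain ⟨p, hp⟩ := height_pos_iff.1 hs
        have hp' := mk_eq_cell.1 hp.symm
        obtain ⟨rfl, rfl⟩ : x = p.1 ∧ s = p.2 := by simpa using hp'
        rw [← hp]
        split_ifs with h
        · rw [cocycle_g, transition_cell_of_lt _ _ h, inv_mul_cancel]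
        · rw [cocycle_g, transition_cell_of_le _ _ (not_lt.1 h), mul_one]
      have hU' : ∀ᶠ s in 𝓝 t, 0 < height (loop x s) :=
        (continuous_height.comp (loop x).continuous).continuousAt.eventually_const_lt hU
      filter_upwards [hU'] with s hs
      exact (key s hs).trans (key t hU).symm
  rw [(cocycle φ).hol_eq _ hF]
  norm_num

/-! ### The loops `u_x` generate the fundamental group -/

/-- A path of the form `y ∧ β(r)` with `y` fixed. -/
def IsStraight {p q : GenWedge X} (κ : Path p q) : Prop :=
  ∃ (y : Plus X) (β : C(I, I)), ∀ r, κ r = mk (Plus.pt X) (y, β r)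

variable {N : Subgroup (PiOneQTop (GenWedge X) (base X))}

/-- Such a loop comes from a path in `I` with endpoints in `{0, 1}` (or is constant, over the added
point). As `I` is simply connected, only the endpoints matter: the class is trivial, `[u_x]` or its
inverse. -/
theorem mk_mem_of_isStraight (hN : ∀ x, PiOneQTop.mk (loop x) ∈ N)
    {κ : Path (base X) (base X)} (hκ : IsStraight κ) : PiOneQTop.mk κ ∈ N := by
  have hrefl : PiOneQTop.mk (Path.refl (base X)) ∈ N := N.one_mem
  have key : ∀ {δ : Path (base X) (base X)}, κ.Homotopic δ → PiOneQTop.mk δ ∈ N →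
      PiOneQTop.mk κ ∈ N := by
    intro δ h hδ
    have : PiOneQTop.mk κ = PiOneQTop.mk δ := Path.Homotopic.Quotient.eq.2 h
    rwa [this]
  obtain ⟨x | _, β, h⟩ := hκ
  · have hf : Continuous fun t : I => mk (Plus.pt X) (Sum.inl x, t) :=
      (loop x).continuous
    have h0 : β 0 = 0 ∨ β 0 = 1 := eq_base_of_mk_inl (by rw [← h, κ.source])
    have h1 : β 1 = 0 ∨ β 1 = 1 := eq_base_of_mk_inl (by rw [← h, κ.target])
    let id' : Path (0 : I) 1 := ⟨⟨id, continuous_id⟩, rfl, rfl⟩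
    rcases h0 with h0 | h0 <;> rcases h1 with h1 | h1
    · refine key (.of_simplyConnectedSpace hf ⟨β, h0, h1⟩ (Path.refl 0) h fun t => ?_) hrefl
      exact (loop x).source.symm
    · exact key (.of_simplyConnectedSpace hf ⟨β, h0, h1⟩ id' h fun t => rfl) (hN x)
    · exact key (.of_simplyConnectedSpace (δ := (loop x).symm) hf ⟨β, h0, h1⟩ id'.symm h
        fun t => rfl) (N.inv_mem (hN x))
    · refine key (.of_simplyConnectedSpace hf ⟨β, h0, h1⟩ (Path.refl 1) h fun t => ?_) hrefl
      exact (loop x).target.symm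
  · have : κ = Path.refl _ := Path.ext (funext fun r => by
      rw [h]
      exact mk_eq_base (Or.inr (Or.inr rfl)))
    rwa [this]

/-- Away from the basepoint the representative `(y, t)` is unique, so both paths lie over the same
`y` and their concatenation is again straight. At the basepoint each is a loop in `N`. -/
theorem symm_trans_mem (hN : ∀ x, PiOneQTop.mk (loop x) ∈ N) {p : GenWedge X}
    {κ μ : Path p (base X)} (hκ : IsStraight κ) (hμ : IsStraight μ) :
    PiOneQTop.mk (κ.symm.trans μ) ∈ N := by
  rcases eq_or_ne p (base X) with rfl | hp
  · exact N.mul_mem (mk_mem_of_isStraight hN hμ) (N.inv_mem (mk_mem_of_isStraight hN hκ))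
  · obtain ⟨y, β, hβ⟩ := hκ
    obtain ⟨z, δ, hδ⟩ := hμ
    have h0 : mk (Plus.pt X) (y, β 0) = p := by rw [← hβ, κ.source]
    have h1 : mk (Plus.pt X) (z, δ 0) = p := by rw [← hδ, μ.source]
    obtain ⟨rfl, h⟩ : y = z ∧ β 0 = δ 0 := by
      rcases mk_eq_mk.1 (h0.trans h1.symm) with h | h
      · exact Prod.ext_iff.1 h
      · exact absurd (h0.symm.trans (mk_eq_base h.1)) hp
    let β' : Path (β 0) (β 1) := ⟨β, rfl, rfl⟩
    let δ' : Path (β 0) (δ 1) := ⟨δ, h.symm, rfl⟩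
    refine mk_mem_of_isStraight hN ⟨y, (β'.symm.trans δ').toContinuousMap, fun r => ?_⟩
    change (κ.symm.trans μ) r = mk (Plus.pt X) (y, (β'.symm.trans δ') r)
    rw [Path.trans_apply, Path.trans_apply]
    split_ifs
    · exact hβ _
    · exact hδ _

/-- A class of paths from the basepoint is in `N` relative to straight paths to the basepoint. -/
def IsReachable (N : Subgroup (PiOneQTop (GenWedge X) (base X))) {p : GenWedge X}
    (γ : Path (base X) p) : Prop :=
  ∀ κ : Path p (base X), IsStraight κ → PiOneQTop.mk (γ.trans κ) ∈ N

theorem mk_trans_eq_mul {p q : GenWedge X} (γ : Path (base X) p) (κ : Path p q)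
    (μ : Path q (base X)) (ν : Path p (base X)) (h : (κ.trans μ).Homotopic ν) :
    PiOneQTop.mk ((γ.trans κ).trans μ) = PiOneQTop.mk (γ.trans ν) := by
  refine Path.Homotopic.Quotient.eq.2 ?_
  exact Path.Homotopic.trans ⟨Path.Homotopy.transAssoc γ κ μ⟩ ((Path.Homotopic.refl γ).hcomp h)

/-- One straight path suffices as a test, since two of them differ by the loop `κ.symm.trans μ`,
whose class is in `N`. -/
theorem isReachable_of_mem (hN : ∀ x, PiOneQTop.mk (loop x) ∈ N) {p : GenWedge X}
    {γ : Path (base X) p} {κ : Path p (base X)} (hκ : IsStraight κ)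
    (h : PiOneQTop.mk (γ.trans κ) ∈ N) : IsReachable N γ := by
  intro μ hμ
  have e : PiOneQTop.mk (γ.trans μ) =
      PiOneQTop.mk (κ.symm.trans μ) * PiOneQTop.mk (γ.trans κ) := by
    change Path.Homotopic.Quotient.mk _ = (Path.Homotopic.Quotient.mk _).trans
      (Path.Homotopic.Quotient.mk _)
    simp only [Path.Homotopic.Quotient.mk_trans, Path.Homotopic.Quotient.mk_symm,
      Path.Homotopic.Quotient.trans_assoc]
    rw [← Path.Homotopic.Quotient.trans_assoc (Path.Homotopic.Quotient.mk κ),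
      Path.Homotopic.Quotient.trans_symm, Path.Homotopic.Quotient.refl_trans]
  rw [e]
  exact N.mul_mem (symm_trans_mem hN hκ hμ) h

theorem IsReachable.congr {p : GenWedge X} {γ δ : Path (base X) p} (h : γ.Homotopic δ)
    (hγ : IsReachable N γ) : IsReachable N δ := by
  intro κ hκ
  have e : PiOneQTop.mk (δ.trans κ) = PiOneQTop.mk (γ.trans κ) :=
    Path.Homotopic.Quotient.eq.2 (h.symm.hcomp (.refl κ))
  rw [e]
  exact hγ κ hκ

/-- The square is a continuous family of straight paths from `α j` to the basepoint. It makes `α`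
followed by the last of them homotopic to the first, and so transfers the test from `p` to `q`. -/
theorem IsReachable.trans_of_square (hN : ∀ x, PiOneQTop.mk (loop x) ∈ N) {p q : GenWedge X}
    {γ : Path (base X) p} (hγ : IsReachable N γ) (α : Path p q) {Q : I × I → GenWedge X}
    (hQ : Continuous Q) (hα : ∀ j, α j = Q (j, 0)) (htop : ∀ j, Q (j, 1) = base X)
    (hstraight : ∀ j, ∃ (y : Plus X) (β : C(I, I)), ∀ r, Q (j, r) = mk (Plus.pt X) (y, β r)) :
    IsReachable N (γ.trans α) := by
  let κ : Path p (base X) :=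
    ⟨⟨fun r => Q (0, r), by fun_prop⟩, by simp [← hα], htop 0⟩
  let μ : Path q (base X) :=
    ⟨⟨fun r => Q (1, r), by fun_prop⟩, by simp [← hα], htop 1⟩
  refine isReachable_of_mem hN (κ := μ) (hstraight 1) ?_
  rw [mk_trans_eq_mul γ α μ κ
    (Path.Homotopic.trans_of_square hQ hα (fun _ => rfl) (fun _ => rfl) htop)]
  exact hγ κ (hstraight 0)

theorem IsReachable.trans_of_height_lt (hN : ∀ x, PiOneQTop.mk (loop x) ∈ N) {p q : GenWedge X}
    {γ : Path (base X) p} (hγ : IsReachable N γ) (α : Path p q)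
    (hα : ∀ j, height (α j) < 1 / 3) : IsReachable N (γ.trans α) := by
  refine hγ.trans_of_square hN α (Q := fun a => push (α a.1) a.2) ?_ (fun j => (push_zero _).symm)
    (fun j => ?_) fun j => ?_
  · exact ContinuousMap.continuous_uncurry_of_continuous
      ⟨fun j => push (α j), continuous_push.comp α.continuous⟩
  · have hj := hα j
    obtain ⟨⟨x | _, t⟩, h⟩ := mk_surjective (α j)
    · rw [← h, height_inl] at hj
      dsimp only
      rw [← h, push_mk]
      refine mk_eq_base ?_
      -- At `r = 1` the coordinate is `3t - 1` clamped to `I`: it is `0` for `t ≤ 1/3` and `1` for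
      -- `t ≥ 2/3`. This matches the bound `1/3` on the height.
      rcases min_lt_iff.1 hj with ht | ht
      · refine Or.inl (projIcc_eq_zero.2 ?_)
        simp only [Set.Icc.coe_one]
        linarith
      · refine Or.inr (Or.inl (projIcc_eq_one.2 ?_))
        simp only [Set.Icc.coe_one]
        linarith
    · dsimp only
      rw [← h, push_mk]
      exact mk_eq_base (Or.inr (Or.inr rfl))
  · obtain ⟨⟨y, t⟩, h⟩ := mk_surjective (α j)
    refine ⟨y, ⟨fun r => projIcc (0 : ℝ) 1 zero_le_one (t + r * (2 * t - 1)), by fun_prop⟩,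
      fun r => ?_⟩
    dsimp only
    rw [← h, push_mk]
    rfl

theorem IsReachable.trans_of_height_pos (hN : ∀ x, PiOneQTop.mk (loop x) ∈ N) {p q : GenWedge X}
    {γ : Path (base X) p} (hγ : IsReachable N γ) (α : Path p q)
    (hα : ∀ j, 0 < height (α j)) : IsReachable N (γ.trans α) := by
  obtain ⟨f, hf⟩ := exists_lift_cell α.continuous hα
  refine hγ.trans_of_square hN α
    -- Within the cell each point slides to the basepoint by scaling its suspension coordinate to
    -- `0`.
    (Q := fun a => mk (Plus.pt X) (Sum.inl (f a.1).1, ((f a.1).2 : I) * unitInterval.symm a.2))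
    ((continuous_mk _).comp ?_) (fun j => ?_) (fun j => ?_) fun j => ?_
  · exact (continuous_inl.comp (by fun_prop)).prodMk (by fun_prop)
  · simpa [cell] using hf j
  · exact mk_eq_base (Or.inl (by simp))
  · exact ⟨Sum.inl (f j).1, ⟨fun r => ((f j).2 : I) * unitInterval.symm r, by fun_prop⟩, fun r => rfl⟩

theorem mk_mem_of_loop_mem (hN : ∀ x, PiOneQTop.mk (loop x) ∈ N) (γ : Path (base X) (base X)) :
    PiOneQTop.mk γ ∈ N := by
  -- Allowing every path that factors through `γ` via some `β`, not only the initial segment of `γ`,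
  -- lets the property pass both forward and backward in time; it is then locally constant on the
  -- connected `I`.
  let P : I → Prop := fun s => ∀ (p : GenWedge X) (δ : Path (base X) p),
    (∃ β : Path 0 s, ∀ r, δ r = γ (β r)) → IsReachable N δ
  have hstep : ∀ {W : Set (GenWedge X)}, IsOpen W →
      (∀ {p q : GenWedge X} {δ : Path (base X) p}, IsReachable N δ → ∀ α : Path p q,
        (∀ j, α j ∈ W) → IsReachable N (δ.trans α)) →
      ∀ s, γ s ∈ W → ∀ᶠ t in 𝓝 s, P t = P s := by
    intro W hW hmove s hs
    have half : ∀ {a b : I} (η : Path a b), (∀ i, γ (η i) ∈ W) → P a → P b := by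
      rintro a b η hη ha q δ ⟨β, hβ⟩
      obtain rfl : γ b = q := by rw [← δ.target, hβ, β.target]
      let α : Path (γ a) (γ b) := η.map γ.continuous
      -- Going back along `α` gives a path to `γ a` that still factors through `γ`; reachability
      -- there moves forward along `α`, and `α.symm` cancels with `α` up to homotopy.
      have h := hmove (ha _ (δ.trans α.symm) ⟨β.trans η.symm, fun r => ?_⟩) α hη
      · refine h.congr (Path.Homotopic.Quotient.eq.1 ?_)
        simp [Path.Homotopic.Quotient.mk_trans, Path.Homotopic.Quotient.mk_symm,
          Path.Homotopic.Quotient.trans_assoc]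
      · rw [Path.trans_apply, Path.trans_apply]
        split_ifs
        · exact hβ _
        · rfl
    obtain ⟨C, ⟨hC1, hC2⟩, hC3⟩ := (path_connected_basis s).mem_iff.1
      ((hW.preimage γ.continuous).mem_nhds hs)
    filter_upwards [hC1] with t ht
    obtain ⟨η, hη⟩ := hC2.joinedIn t ht s (mem_of_mem_nhds hC1)
    exact propext ⟨half η fun i => hC3 (hη i), half η.symm fun i => hC3 (hη _)⟩
  have hloc : IsLocallyConstant P := by
    rw [IsLocallyConstant.iff_eventually_eq]
    intro s
    rcases lt_or_ge 0 (height (γ s)) with h | h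
    · exact hstep (isOpen_lt continuous_const continuous_height)
        (fun hδ α hα => hδ.trans_of_height_pos hN α hα) s h
    · exact hstep (isOpen_lt continuous_height continuous_const)
        (fun hδ α hα => hδ.trans_of_height_lt hN α hα) s (h.trans_lt (by norm_num : (0 : ℝ) < 1 / 3))
  have h0 : P 0 := by
    rintro p δ ⟨β, hβ⟩
    obtain rfl : base X = p := by rw [← δ.target, hβ, β.target, γ.source]
    -- Here `β` is a loop in `I`, hence null-homotopic.
    have h : (Path.refl (base X)).Homotopic δ :=
      .of_simplyConnectedSpace γ.continuous (Path.refl 0) β (fun _ => γ.source.symm) hβ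
    refine IsReachable.congr h fun κ hκ => ?_
    exact N.mul_mem (mk_mem_of_isStraight hN hκ) N.one_mem
  have h1 : P 1 := by rwa [hloc.apply_eq_of_preconnectedSpace 1 0]
  have h := h1 _ γ ⟨⟨⟨id, continuous_id⟩, rfl, rfl⟩, fun r => rfl⟩ (Path.refl _)
    ⟨Plus.pt X, ContinuousMap.const I 0, fun r => rfl⟩
  have e : PiOneQTop.mk (γ.trans (Path.refl _)) = PiOneQTop.mk γ :=
    Path.Homotopic.Quotient.eq.2 ⟨Path.Homotopy.transRefl γ⟩
  rwa [e] at h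

/-! ### The isomorphism -/

/-- In the square `(j, t) ↦ γ(j) ∧ t` the bottom and top sides are collapsed, so the vertical sides
are homotopic loops. -/
theorem loop_homotopic {x y : X} (γ : Path x y) : (loop x).Homotopic (loop y) := by
  have h : ((Path.refl (base X)).trans (loop y)).Homotopic (loop x) := by
    refine Path.Homotopic.trans_of_square (Q := fun a => mk (Plus.pt X) (Sum.inl (γ a.1), a.2))
      ((continuous_mk _).comp ((continuous_inl.comp (by fun_prop)).prodMk (by fun_prop)))
      (fun j => (mk_eq_base (Or.inl rfl)).symm) (fun t => ?_) (fun t => ?_)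
      fun j => mk_eq_base (Or.inr (Or.inl rfl))
    · simp only [γ.source]
      rfl
    · simp only [γ.target]
      rfl
  exact h.symm.trans ⟨Path.Homotopy.reflTrans (loop y)⟩

variable (X) in
/-- The map `[x] ↦ [u_x]` on path components. -/
def loopClass : C(ZerothHomotopy X, PiOneTau (GenWedge X) (base X)) where
  toFun := ZerothHomotopy.lift (fun x => PiOneTau.mk (loop x)) fun _ _ γ =>
    congrArg (Tau.refl _) (Path.Homotopic.Quotient.eq.2 (loop_homotopic γ))
  continuous_toFun := by
    have h1 : Continuous (loop : X → Path (base X) (base X)) := by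
      refine continuous_induced_rng.2 (ContinuousMap.continuous_of_continuous_uncurry _ ?_)
      exact (continuous_mk _).comp ((continuous_inl.comp continuous_fst).prodMk continuous_snd)
    have h2 : Continuous (PiOneQTop.mk : Path (base X) (base X) → _) := continuous_coinduced_rng
    exact ZerothHomotopy.isQuotientMap_mk.continuous_iff.2
      ((Tau.continuous_refl _).comp (h2.comp h1))

/-- The holonomy homomorphism of the cocycle of `φ`. -/
def holHom {G : Type*} [Group G] (φ : ZerothHomotopy X → G) :
    PiOneTau (GenWedge X) (base X) →* G :=
  MonoidHom.mk' (fun a => Quotient.lift (s := Path.Homotopic.setoid (base X) (base X))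
    (cocycle φ).hol (fun _ _ h =>
      (cocycle φ).hol_congr (base_mem_cocycle_V φ) (base_mem_cocycle_V φ) h) a) (by
    intro a b
    induction a using Quotient.inductionOn with | _ α
    induction b using Quotient.inductionOn with | _ β
    -- The product of the classes of `α` and `β` is the class of `β.trans α`, and holonomy reverses
    -- concatenation; the two reversals cancel.
    exact (cocycle φ).hol_trans β α)

/-- Continuity on `π₁^qtop` is continuity on loops. Because `G` is a topological group, it extends
to `F_M(π₁^qtop)` and descends along the quotient map defining `π₁^τ`. -/
theorem continuous_holHom {G : Type*} [Group G] [TopologicalSpace G] [IsTopologicalGroup G]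
    {φ : ZerothHomotopy X → G} (hφ : Continuous φ) : Continuous (holHom φ) := by
  have h : Continuous fun a : PiOneQTop (GenWedge X) (base X) => holHom φ (Tau.refl _ a) :=
    continuous_coinduced_dom.2 ((cocycle φ).continuous_hol (base_mem_cocycle_V φ)
      (base_mem_cocycle_V φ) fun z hz => continuousAt_cocycle_g hφ hz)
  refine (Tau.isQuotientMap_mult _).continuous_iff.2 ?_
  have e : FreeTopGroup.liftHom (fun a => holHom φ (Tau.refl _ a)) =
      (holHom φ).comp (Tau.mult _) :=
    FreeTopGroup.hom_ext fun a => by simp [Tau.mult, FreeTopGroup.liftHom_of]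
  have := FreeTopGroup.continuous_liftHom h
  rw [e] at this
  exact this

theorem holHom_lift_loopClass (w : FreeTopGroup (ZerothHomotopy X)) :
    holHom FreeTopGroup.of (FreeTopGroup.lift (loopClass X) w) = w := by
  have e : (holHom FreeTopGroup.of).comp (FreeTopGroup.lift (loopClass X)).toMonoidHom =
      MonoidHom.id _ := by
    refine FreeTopGroup.hom_ext fun y => ?_
    induction y with | mk x
    exact (congrArg (holHom FreeTopGroup.of)
      (FreeTopGroup.lift_of (loopClass X) (ZerothHomotopy.mk x))).trans
        (hol_loop FreeTopGroup.of x)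
  exact DFunLike.congr_fun e w

theorem lift_loopClass_surjective : Function.Surjective (FreeTopGroup.lift (loopClass X)) := by
  intro a
  obtain ⟨γ, rfl⟩ := Path.Homotopic.Quotient.mk_surjective a
  -- `Tau` changes only the topology, so the range is also a subgroup of the underlying fundamental
  -- group.
  let N : Subgroup (PiOneQTop (GenWedge X) (base X)) :=
    (FreeTopGroup.lift (loopClass X)).toMonoidHom.range
  exact mk_mem_of_loop_mem (N := N)
    (fun x => ⟨FreeTopGroup.of (ZerothHomotopy.mk x), FreeTopGroup.lift_of _ _⟩) γ

variable (X) in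
/-- The isomorphism of topological groups `F_M(π₀(X)) ≃ π₁^τ(Σ(X₊))`. -/
def freeTopGroupEquiv :
    FreeTopGroup (ZerothHomotopy X) ≃ₜ* PiOneTau (GenWedge X) (base X) where
  toFun := FreeTopGroup.lift (loopClass X)
  invFun := holHom FreeTopGroup.of
  left_inv := holHom_lift_loopClass
  right_inv a := by
    obtain ⟨w, rfl⟩ := lift_loopClass_surjective a
    rw [holHom_lift_loopClass]
  map_mul' := map_mul _
  continuous_toFun := (FreeTopGroup.lift (loopClass X)).continuous_toFun
  continuous_invFun := continuous_holHom FreeTopGroup.continuous_of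

theorem freeTopGroupEquiv_of (x : X) :
    freeTopGroupEquiv X (FreeTopGroup.of (ZerothHomotopy.mk x)) = PiOneTau.mk (loop x) :=
  FreeTopGroup.lift_of (loopClass X) (ZerothHomotopy.mk x)

theorem map_mk_loop {Y : Type*} [TopologicalSpace Y] (f : C(X, Y)) (x : X) :
    PiOneTau.map (map f) (map_base f) (PiOneTau.mk (loop x)) = PiOneTau.mk (loop (f x)) :=
  congrArg (Tau.refl _) (FundamentalGroup.mapOfEq_apply (map f) (map_base f)
    (FundamentalGroup.fromPath (Path.Homotopic.Quotient.mk (loop x))))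

theorem freeTopGroupEquiv_map {Y : Type*} [TopologicalSpace Y] (f : C(X, Y))
    (w : FreeTopGroup (ZerothHomotopy X)) :
    freeTopGroupEquiv Y (FreeTopGroup.map (piZeroMap f) w) =
      PiOneTau.map (map f) (map_base f) (freeTopGroupEquiv X w) := by
  have e : (FreeTopGroup.lift (loopClass Y)).toMonoidHom.comp
      (FreeTopGroup.map (piZeroMap f)).toMonoidHom =
      (PiOneTau.map (map f) (map_base f)).toMonoidHom.comp
        (FreeTopGroup.lift (loopClass X)).toMonoidHom := by
    refine FreeTopGroup.hom_ext fun y => ?_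
    induction y with | mk x
    have h1 : FreeTopGroup.map (piZeroMap f) (FreeTopGroup.of (ZerothHomotopy.mk x)) =
        FreeTopGroup.of (ZerothHomotopy.mk (f x)) := FreeTopGroup.lift_of _ _
    exact (congrArg (freeTopGroupEquiv Y) h1).trans ((freeTopGroupEquiv_of (f x)).trans
      ((map_mk_loop f x).symm.trans
        (congrArg (PiOneTau.map (map f) (map_base f)) (freeTopGroupEquiv_of x).symm)))
  exact DFunLike.congr_fun e w

end GenWedge

end TopPiOne

end

end

theorem mainTheorem1 :
    ∃ h : ∀ (X : Type u) [TopologicalSpace X],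
        TopPiOne.FreeTopGroup (ZerothHomotopy X) ≃ₜ*
          TopPiOne.PiOneTau (TopPiOne.GenWedge X) (TopPiOne.GenWedge.base X),
      (∀ (X : Type u) [TopologicalSpace X] (x : X),
        h X (TopPiOne.FreeTopGroup.of (ZerothHomotopy.mk x)) =
          TopPiOne.PiOneTau.mk (TopPiOne.GenWedge.loop x)) ∧
      ∀ (X Y : Type u) [TopologicalSpace X] [TopologicalSpace Y] (f : C(X, Y))
        (w : TopPiOne.FreeTopGroup (ZerothHomotopy X)),
        h Y (TopPiOne.FreeTopGroup.map (TopPiOne.piZeroMap f) w) =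
          TopPiOne.PiOneTau.map (TopPiOne.GenWedge.map f) (TopPiOne.GenWedge.map_base f) (h X w) :=
  ⟨fun X _ => TopPiOne.GenWedge.freeTopGroupEquiv X,
    fun _ _ x => TopPiOne.GenWedge.freeTopGroupEquiv_of x,
    fun _ _ _ _ f w => TopPiOne.GenWedge.freeTopGroupEquiv_map f w⟩
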